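/- Let $d \ge 1$ and let $D$ be a probability distribution on $\mathbb{R}^d$ that is absolutely continuous with respect to Lebesgue measure and balanced about some point $\boldsymbol{p} \in \mathbb{R}^d$, in the sense that for every hyperplane through $\boldsymbol{p}$ the two open half-spaces it bounds have equal $D$-measure. For $m, n \in \mathbb{N}$ let $\mathcal{E}_{m,n,D}$ denote a random point set consisting of $m$ colour classes with $n$ points each, all $mn$ points being independent with distribution $D$; it is called Tverberg if the convex hulls of its $m$ colour classes have a point in common. Events $A_m$ occur with high probability if $\lim_{m\to\infty}\mathbb{P}(A_m) = 1$. Let $f : \mathbb{N} \to \mathbb{N}$. Then: 1. If $f(m) \gg \log_2 m$ (that is, $\log_2 m = o(f(m))$ as $m \to \infty$), then $\mathcal{E}_{m,f(m),D}$ is Tverberg with high probability. 2. If $f(m) \ll \log_2 m$ (that is, $f(m) = o(\log_2 m)$ as $m\to\infty$), then $\mathcal{E}_{m,f(m),D}$ is not Tverberg with high probability (i.e. $\mathbb{P}(\mathcal{E}_{m,f(m),D}\text{ is not Tverberg}) \to 1$). Moreover, the threshold is sharp, in that for every fixed $\varepsilon > 0$: 3. If $f(m) \ge (1+\varepsilon)\log_2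 m$ for all sufficiently large $m$, then $\mathcal{E}_{m,f(m),D}$ is Tverberg with high probability. 4. If $f(m) \le (1-\varepsilon)\log_2 m$ for all sufficiently large $m$, then $\mathcal{E}_{m,f(m),D}$ is not Tverberg with high probability. -/

import Mathlib

open MeasureTheory Filter Topology Asymptotics

/-- `D` is balanced about `p`: every hyperplane `{x | ⟪v, x - p⟫ = 0}` through `p` (with normal
vector `v ≠ 0`) has the same `D`-measure on its two sides. -/
def BalancedAbout {d : ℕ} (D : Measure (EuclideanSpace ℝ (Fin d)))
    (p : EuclideanSpace ℝ (Fin d)) : Prop :=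
  ∀ v : EuclideanSpace ℝ (Fin d), v ≠ 0 →
    D {x | inner ℝ v (x - p) < 0} = D {x | 0 < inner ℝ v (x - p)}

/-- The law of the random equi-partitioned point set with `m` colours and `n` points of each
colour: the points `X (i, j)` (the `j`-th point of colour `i`) are independent with law `D`. -/
noncomputable def equiPartitionLaw {d : ℕ} (m n : ℕ) (D : Measure (EuclideanSpace ℝ (Fin d))) :
    Measure (Fin m × Fin n → EuclideanSpace ℝ (Fin d)) :=
  Measure.pi fun _ => D

/-- A coloured point configuration is Tverberg if the convex hulls of its colour classes have a
common point. -/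
def IsTverberg {d m n : ℕ} (X : Fin m × Fin n → EuclideanSpace ℝ (Fin d)) : Prop :=
  (⋂ i : Fin m, convexHull ℝ (Set.range fun j : Fin n => X (i, j))).Nonempty

/-- The events `{ω | A m ω}` occur with high probability: their probabilities tend to `1`. -/
def WithHighProbability {Ω : ℕ → Type*} [∀ m, MeasurableSpace (Ω m)]
    (P : ∀ m, Measure (Ω m)) (A : ∀ m, Ω m → Prop) : Prop :=
  Tendsto (fun m => P m {ω | A m ω}) atTop (𝓝 1)

/-! The threshold is governed by the probability `π n` that a given point lies outside the convex
hull of `n` independent points with law `D`.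

Above the threshold, all hulls contain `p` itself. If the hull of a colour class misses `p`, the
class lies in an open half-space bounded by a hyperplane through `p`. Such half-spaces have measure
`1 / 2`, and by compactness of the unit sphere finitely many cones of measure below any prescribed
`s > 1 / 2` suffice to contain, for every unit normal, the corresponding half-space. Hence
`π n ≤ N * s ^ n` (`exists_measure_notMem_convexHull_le`), and a union bound over the `m` colours
(`measure_isEmpty_commonHull_le`) finishes the argument, as `m * s ^ n → 0` when `s` is close enough
to `1 / 2`.

Below the threshold, every point `q` is on the boundary of an open half-space of measure at least
`1 / 2`, so `π n ≥ 2⁻ⁿ` at `q`, and `k` independent hulls all contain `q` with probability at most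
`(1 - 2⁻ⁿ) ^ k` (`measure_mem_convexHull_le`). Only few points `q` need to be tried: if all hulls
meet, let `q` be the point of their intersection nearest to the origin. By Helly's theorem `q` is
already the nearest point of the intersection of some `d` of the hulls
(`exists_mem_determinedBy`, `mem_commonHull_univ_of_mem_determinedBy`), and so is independent of the
other `m - d` colours (`measure_determinedBy_le`). The probability that the configuration is
Tverberg is therefore at most `m.choose d * (1 - 2⁻ⁿ) ^ (m - d)` (`measure_nonempty_commonHull_le`), a
polynomial in `m` times at most `exp (-m ^ ε / 2)`. -/

/-! ### Convex hulls of coloured configurations -/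

theorem convexHull_range_eq_image_stdSimplex {ι V : Type*} [Fintype ι] [AddCommGroup V]
    [Module ℝ V] (x : ι → V) :
    convexHull ℝ (Set.range x) = (fun w : ι → ℝ => ∑ j, w j • x j) '' stdSimplex ℝ ι := by
  classical
  have h := (Fintype.linearCombination ℝ x).image_convexHull
    (Set.range fun i j : ι => if i = j then (1 : ℝ) else 0)
  rw [convexHull_basis_eq_stdSimplex, ← Set.range_comp] at h
  have hx :
      Fintype.linearCombination ℝ x ∘ (fun i j : ι => if i = j then (1 : ℝ) else 0) = x := by
    funext i
    simp [Fintype.linearCombination_apply]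
  rw [hx] at h
  exact h.symm

theorem isClosed_setOf_mem_convexHull_range {ι V : Type*} [Fintype ι] [AddCommGroup V]
    [Module ℝ V] [TopologicalSpace V] [T2Space V] [IsTopologicalAddGroup V] [ContinuousSMul ℝ V] :
    IsClosed {z : (ι → V) × V | z.2 ∈ convexHull ℝ (Set.range z.1)} := by
  have : CompactSpace (stdSimplex ℝ ι) := isCompact_iff_compactSpace.1 (isCompact_stdSimplex ℝ ι)
  have hC : IsClosed {y : ((ι → V) × V) × stdSimplex ℝ ι |
      ∑ j, (Subtype.val y.2) j • y.1.1 j = y.1.2} :=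
    isClosed_eq (continuous_finsetSum _ fun j _ =>
      ((continuous_apply j).comp (continuous_subtype_val.comp continuous_snd)).smul
        (by fun_prop)) (by fun_prop)
  convert isClosedMap_fst_of_compactSpace _ hC using 1
  ext z
  simp only [convexHull_range_eq_image_stdSimplex, Set.mem_image, Set.mem_ofPred_eq]
  exact ⟨fun ⟨w, hw, h⟩ => ⟨(z, ⟨w, hw⟩), h, rfl⟩,
    by rintro ⟨⟨y, w⟩, h, rfl⟩; exact ⟨w.1, w.2, h⟩⟩

section Geometry

variable {κ ι V : Type*}

/-- The common part of the convex hulls of the colour classes with colours in `I`. -/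
def commonHull [AddCommGroup V] [Module ℝ V] (I : Finset κ) (X : κ × ι → V) : Set V :=
  ⋂ i ∈ I, convexHull ℝ (Set.range fun j => X (i, j))

theorem mem_commonHull [AddCommGroup V] [Module ℝ V] {I : Finset κ} {X : κ × ι → V} {q : V} :
    q ∈ commonHull I X ↔ ∀ i ∈ I, q ∈ convexHull ℝ (Set.range fun j => X (i, j)) := by
  simp [commonHull]

theorem commonHull_anti [AddCommGroup V] [Module ℝ V] {I J : Finset κ} (h : I ⊆ J)
    (X : κ × ι → V) : commonHull J X ⊆ commonHull I X := by
  intro q hq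
  rw [mem_commonHull] at hq ⊢
  exact fun i hi => hq i (h hi)

theorem convex_commonHull [AddCommGroup V] [Module ℝ V] (I : Finset κ) (X : κ × ι → V) :
    Convex ℝ (commonHull I X) :=
  convex_iInter₂ fun _ _ => convex_convexHull ℝ _

variable [Fintype ι] [NormedAddCommGroup V] [NormedSpace ℝ V]

theorem isClosed_commonHull (I : Finset κ) (X : κ × ι → V) : IsClosed (commonHull I X) :=
  isClosed_biInter fun _ _ => (Set.finite_range _).isClosed_convexHull ℝ

theorem isClosed_setOf_exists_mem_commonHull [ProperSpace V] (I : Finset κ) (r : ℝ) :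
    IsClosed {X : κ × ι → V | ∃ q ∈ commonHull I X, ‖q‖ ≤ r} := by
  have : CompactSpace (Metric.closedBall (0 : V) r) :=
    isCompact_iff_compactSpace.1 (isCompact_closedBall 0 r)
  have hC : IsClosed {y : (κ × ι → V) × Metric.closedBall (0 : V) r |
      (y.2 : V) ∈ commonHull I y.1} := by
    simp only [mem_commonHull, Set.ofPred_forall]
    refine isClosed_biInter fun i _ => ?_
    exact (isClosed_setOf_mem_convexHull_range (ι := ι) (V := V)).preimage
      (f := fun y : (κ × ι → V) × Metric.closedBall (0 : V) r =>
        ((fun j => y.1 (i, j)), (y.2 : V))) (by fun_prop)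
  convert isClosedMap_fst_of_compactSpace _ hC using 1
  ext X
  simp [and_comm]

theorem exists_norm_le_of_mem_commonHull [ProperSpace V] {I : Finset κ} {X : κ × ι → V}
    (h : (commonHull I X).Nonempty) :
    ∃ q ∈ commonHull I X, ∀ q' ∈ commonHull I X, ‖q‖ ≤ ‖q'‖ := by
  obtain ⟨q, hq, hd⟩ := (isClosed_commonHull I X).exists_infDist_eq_dist h 0
  refine ⟨q, hq, fun q' hq' => ?_⟩
  have := Metric.infDist_le_dist_of_mem (x := (0 : V)) hq'
  rwa [hd, dist_zero_left, dist_zero_left] at this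

/-- The configurations in which all the hulls meet and the hulls with colours in `I` already
determine how close to the origin they do so. Rational radii keep this a countable combination of
closed conditions. -/
def determinedBy [Fintype κ] (I : Finset κ) : Set (κ × ι → V) :=
  {X | (commonHull Finset.univ X).Nonempty ∧ ∀ r : ℚ, (∃ q ∈ commonHull I X, ‖q‖ ≤ (r : ℝ)) →
    ∃ q ∈ commonHull Finset.univ X, ‖q‖ ≤ (r : ℝ)}

theorem measurableSet_determinedBy [ProperSpace V] [Fintype κ] [MeasurableSpace V] [BorelSpace V]
    [SecondCountableTopology V] (I : Finset κ) :
    MeasurableSet (determinedBy I : Set (κ × ι → V)) := by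
  have key (J : Finset κ) (r : ℝ) :
      MeasurableSet {X : κ × ι → V | ∃ q ∈ commonHull J X, ‖q‖ ≤ r} :=
    (isClosed_setOf_exists_mem_commonHull J r).measurableSet
  have hne : {X : κ × ι → V | (commonHull Finset.univ X).Nonempty} =
      ⋃ n : ℕ, {X | ∃ q ∈ commonHull Finset.univ X, ‖q‖ ≤ n} := by
    ext X
    simp only [Set.mem_ofPred_eq, Set.mem_iUnion]
    constructor
    · rintro ⟨q, hq⟩
      exact (exists_nat_ge ‖q‖).imp fun n hn => ⟨q, hq, hn⟩
    · rintro ⟨_, q, hq, _⟩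
      exact ⟨q, hq⟩
  unfold determinedBy
  rw [Set.ofPred_and, Set.ofPred_forall, hne]
  refine (MeasurableSet.iUnion fun n => key _ _).inter (MeasurableSet.iInter fun r => ?_)
  simp only [imp_iff_not_or, Set.ofPred_or]
  exact (key I r).compl.union (key _ r)

/-- Helly's theorem, applied to the hulls and the open ball whose radius is the distance `r` from
the origin to the intersection of all hulls: if every `d` hulls met inside the ball, all would. -/
theorem exists_mem_determinedBy [FiniteDimensional ℝ V] [Fintype κ]
    (hκ : Module.finrank ℝ V ≤ Fintype.card κ) {X : κ × ι → V}
    (h : (commonHull Finset.univ X).Nonempty) :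
    ∃ I : Finset κ, I.card = Module.finrank ℝ V ∧ X ∈ determinedBy I := by
  classical
  have : ProperSpace V := FiniteDimensional.proper ℝ V
  obtain ⟨q, hq, hmin⟩ := exists_norm_le_of_mem_commonHull h
  let F : Option κ → Set V := fun o =>
    o.elim (Metric.ball 0 ‖q‖) fun i => convexHull ℝ (Set.range fun j => X (i, j))
  have hF : ∃ J : Finset (Option κ), J.card ≤ Module.finrank ℝ V + 1 ∧
      ¬ (⋂ o ∈ J, F o).Nonempty := by
    by_contra! hcon
    obtain ⟨x, hx⟩ := Convex.helly_theorem' (𝕜 := ℝ) (F := F) (s := Finset.univ)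
      (fun o _ => by
        cases o with
        | none => exact convex_ball 0 _
        | some i => exact convex_convexHull ℝ _)
      (fun J _ hJ => hcon J hJ)
    simp only [Set.mem_iInter] at hx
    have h1 : x ∈ Metric.ball 0 ‖q‖ := hx none (Finset.mem_univ _)
    have h2 : x ∈ commonHull Finset.univ X :=
      mem_commonHull.2 fun i _ => hx (some i) (Finset.mem_univ _)
    rw [mem_ball_zero_iff] at h1
    exact absurd (hmin x h2) (not_le.2 h1)
  obtain ⟨J, hJ, hJne⟩ := hF
  have hnone : none ∈ J := by
    by_contra hn
    refine hJne ⟨q, Set.mem_iInter₂.2 fun o ho => ?_⟩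
    cases o with
    | none => exact absurd ho hn
    | some i => exact mem_commonHull.1 hq i (Finset.mem_univ i)
  have hcard : J.eraseNone.card ≤ Module.finrank ℝ V := by
    have := Finset.card_eraseNone_of_mem hnone
    omega
  obtain ⟨I, hJI, hI⟩ := Finset.exists_superset_card_eq hcard hκ
  refine ⟨I, hI, ⟨q, hq⟩, ?_⟩
  rintro r ⟨x, hx, hxr⟩
  refine ⟨q, hq, le_trans ?_ hxr⟩
  by_contra! hlt
  refine hJne ⟨x, Set.mem_iInter₂.2 fun o ho => ?_⟩
  cases o with
  | none => exact mem_ball_zero_iff.2 hlt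
  | some i => exact mem_commonHull.1 hx i (hJI (Finset.mem_eraseNone.2 ho))

/-- A configuration determined by the colours in `I` has, as a point common to all hulls, the
point of `commonHull I X` nearest to the origin, which is unique by strict convexity. -/
theorem mem_commonHull_univ_of_mem_determinedBy [ProperSpace V] [StrictConvexSpace ℝ V]
    [Fintype κ] {I : Finset κ} {X : κ × ι → V} (hX : X ∈ determinedBy I) {q : V}
    (hq : q ∈ commonHull I X) (hmin : ∀ q' ∈ commonHull I X, ‖q‖ ≤ ‖q'‖) :
    q ∈ commonHull Finset.univ X := by
  obtain ⟨x, hx, hxmin⟩ := exists_norm_le_of_mem_commonHull hX.1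
  have hxI := commonHull_anti (Finset.subset_univ I) X hx
  have hle : ‖x‖ ≤ ‖q‖ := by
    refine le_of_forall_gt_imp_ge_of_dense fun a ha => ?_
    obtain ⟨r, hr1, hr2⟩ := exists_rat_btwn ha
    obtain ⟨y, hy, hyr⟩ := hX.2 r ⟨q, hq, hr1.le⟩
    exact ((hxmin y hy).trans hyr).trans hr2.le
  have heq : ‖x‖ = ‖q‖ := le_antisymm hle (hmin x hxI)
  by_cases hne : x = q
  · exact hne ▸ hx
  · have hlt := (norm_midpoint_lt_iff heq).2 hne
    have hmid : (1 / 2 : ℝ) • (x + q) ∈ commonHull I X := by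
      rw [smul_add]
      exact convex_commonHull I X hxI hq (by norm_num) (by norm_num) (by norm_num)
    exact absurd (hmin _ hmid) (not_le.2 (heq ▸ hlt))

end Geometry

/-! ### Independence of coordinates and of colour classes -/

section Independence

variable {α κ ι V : Type*} [Fintype α] [Fintype κ] [Fintype ι] [MeasurableSpace V]

/-- Resampling some of the coordinates of an i.i.d. family does not change its law. -/
theorem measurePreserving_piecewise (D : Measure V) [IsProbabilityMeasure D] (s : Set α)
    [DecidablePred (· ∈ s)] :
    MeasurePreserving (fun z : (α → V) × (α → V) => s.piecewise z.1 z.2)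
      ((Measure.pi fun _ => D).prod (Measure.pi fun _ => D)) (Measure.pi fun _ => D) := by
  have hm : Measurable (fun z : (α → V) × (α → V) => s.piecewise z.1 z.2) := by
    refine measurable_pi_lambda _ fun a => ?_
    by_cases ha : a ∈ s
    · simp only [Set.piecewise, ha, if_true]; fun_prop
    · simp only [Set.piecewise, ha, if_false]; fun_prop
  refine ⟨hm, (Measure.pi_eq fun t ht => ?_).symm⟩
  rw [Measure.map_apply hm (MeasurableSet.univ_pi ht)]
  have hpre : (fun z : (α → V) × (α → V) => s.piecewise z.1 z.2) ⁻¹' Set.univ.pi t =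
      (Set.univ.pi fun a => if a ∈ s then t a else Set.univ) ×ˢ
        (Set.univ.pi fun a => if a ∈ s then Set.univ else t a) := by
    ext z
    simp only [Set.mem_preimage, Set.mem_univ_pi, Set.mem_prod, ← forall_and]
    refine forall_congr' fun a => ?_
    by_cases ha : a ∈ s <;> simp [ha]
  rw [hpre, Measure.prod_prod, Measure.pi_pi, Measure.pi_pi, ← Finset.prod_mul_distrib]
  refine Finset.prod_congr rfl fun a _ => ?_
  by_cases ha : a ∈ s <;> simp [ha]

theorem pi_le_of_forall_piecewise (D : Measure V) [IsProbabilityMeasure D] (s : Set α)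
    [DecidablePred (· ∈ s)] {A : Set (α → V)} (hA : MeasurableSet A) {c : ENNReal}
    (h : ∀ x, (Measure.pi fun _ => D) {y : α → V | s.piecewise x y ∈ A} ≤ c) :
    (Measure.pi fun _ => D) A ≤ c := by
  have hp := measurePreserving_piecewise D s
  rw [← hp.measure_preimage hA.nullMeasurableSet, Measure.prod_apply (hp.measurable hA)]
  calc _ ≤ ∫⁻ _, c ∂(Measure.pi fun _ => D) := lintegral_mono fun x => h x
    _ = c := by simp

theorem measurePreserving_curry (D : Measure V) [IsProbabilityMeasure D] :
    MeasurePreserving (MeasurableEquiv.curry κ ι V) (Measure.pi fun _ => D)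
      (Measure.pi fun _ => Measure.pi fun _ => D) := by
  have h : MeasurePreserving (MeasurableEquiv.curry κ ι V).symm
      (Measure.pi fun _ => Measure.pi fun _ => D) (Measure.pi fun _ => D) := by
    refine ⟨MeasurableEquiv.measurable _, (Measure.pi_eq fun t ht => ?_).symm⟩
    rw [MeasurableEquiv.map_apply]
    have hpre : (MeasurableEquiv.curry κ ι V).symm ⁻¹' Set.univ.pi t =
        Set.univ.pi fun i => Set.univ.pi fun j => t (i, j) := by
      ext Y
      simp [MeasurableEquiv.curry, Function.uncurry]
    rw [hpre, Measure.pi_pi]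
    simp only [Measure.pi_pi]
    rw [Fintype.prod_prod_type]
  exact h.symm

/-- Distinct colour classes are independent. -/
theorem pi_setOf_forall_mem_colour (D : Measure V) [IsProbabilityMeasure D] (J : Finset κ)
    (S : Set (ι → V)) :
    (Measure.pi fun _ => D) {X : κ × ι → V | ∀ i ∈ J, (fun j => X (i, j)) ∈ S} =
      ((Measure.pi fun _ => D) S) ^ J.card := by
  classical
  have hset : {X : κ × ι → V | ∀ i ∈ J, (fun j => X (i, j)) ∈ S} =
      MeasurableEquiv.curry κ ι V ⁻¹'
        (Set.univ.pi fun i => if i ∈ J then S else Set.univ) := by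
    ext X
    simp only [Set.mem_ofPred_eq, Set.mem_preimage, Set.mem_univ_pi]
    refine forall_congr' fun i => ?_
    by_cases hi : i ∈ J
    · simp only [hi, forall_const, if_true]; rfl
    · simp [hi]
  rw [hset, (measurePreserving_curry D).measure_preimage_equiv, Measure.pi_pi]
  simp [apply_ite]

end Independence

/-! ### Half-spaces and the probability that hulls contain a point -/

section Hyperplane

variable {V : Type*} [NormedAddCommGroup V] [InnerProductSpace ℝ V] [MeasurableSpace V]

theorem measure_isEmpty_commonHull_le {κ ι : Type*} [Fintype κ] [Fintype ι]
    {D : Measure V} [IsProbabilityMeasure D] (p : V) :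
    (Measure.pi fun _ => D) {X : κ × ι → V | ¬ (commonHull Finset.univ X).Nonempty} ≤
      Fintype.card κ *
        (Measure.pi fun _ => D) {x : ι → V | p ∉ convexHull ℝ (Set.range x)} := by
  calc _ ≤ (Measure.pi fun _ => D) (⋃ i : κ, {X : κ × ι → V | ∀ i' ∈ ({i} : Finset κ),
          (fun j => X (i', j)) ∈ {x : ι → V | p ∉ convexHull ℝ (Set.range x)}}) := by
        refine measure_mono fun X hX => ?_
        by_contra hcon
        refine hX ⟨p, mem_commonHull.2 fun i _ => ?_⟩
        by_contra hi
        exact hcon (Set.mem_iUnion.2 ⟨i, by simpa using hi⟩)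
    _ ≤ ∑ i : κ, (Measure.pi fun _ => D) {X : κ × ι → V | ∀ i' ∈ ({i} : Finset κ),
          (fun j => X (i', j)) ∈ {x : ι → V | p ∉ convexHull ℝ (Set.range x)}} :=
        measure_iUnion_fintype_le _ _
    _ = _ := by simp only [pi_setOf_forall_mem_colour]; simp
theorem measurableSet_halfSpace [BorelSpace V] (v p : V) :
    MeasurableSet {x : V | 0 < inner ℝ v (x - p)} :=
  (isOpen_lt continuous_const (by fun_prop)).measurableSet

variable [BorelSpace V] [FiniteDimensional ℝ V]

theorem measure_hyperplane_eq_zero {D : Measure V} (hD : D ≪ volume) (p : V) {v : V}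
    (hv : v ≠ 0) : D {x | inner ℝ v (x - p) = 0} = 0 := by
  refine hD ?_
  have h := Measure.addHaar_affineSubspace (volume : Measure V)
    (AffineSubspace.mk' p (ℝ ∙ v)ᗮ) (fun h => ?_)
  · convert h using 2
    ext x
    simp [AffineSubspace.mem_mk', Submodule.mem_orthogonal_singleton_iff_inner_right]
  · have : p + v ∈ AffineSubspace.mk' p (ℝ ∙ v)ᗮ := h ▸ AffineSubspace.mem_top ℝ V (p + v)
    simp [AffineSubspace.mem_mk', Submodule.mem_orthogonal_singleton_iff_inner_right, hv] at this

theorem measure_halfSpace_add {D : Measure V} [IsProbabilityMeasure D] (hD : D ≪ volume) (p : V)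
    {v : V} (hv : v ≠ 0) :
    D {x | inner ℝ v (x - p) < 0} + D {x | 0 < inner ℝ v (x - p)} = 1 := by
  have hdisj : Disjoint {x : V | inner ℝ v (x - p) < 0} {x | 0 < inner ℝ v (x - p)} :=
    Set.disjoint_left.2 fun x hx hx' => lt_asymm (show inner ℝ v (x - p) < 0 from hx) hx'
  rw [← measure_union hdisj (measurableSet_halfSpace v p), ← measure_univ (μ := D)]
  refine (measure_congr ?_).symm
  refine (ae_eq_univ.2 (measure_mono_null ?_ (measure_hyperplane_eq_zero hD p hv))).symm
  intro x hx
  simp only [Set.mem_compl_iff, Set.mem_union, Set.mem_ofPred_eq, not_or, not_lt] at hx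
  exact le_antisymm hx.2 hx.1

theorem exists_half_le_measure_halfSpace [Nontrivial V] {D : Measure V} [IsProbabilityMeasure D]
    (hD : D ≪ volume) (q : V) : ∃ v : V, 2⁻¹ ≤ D {x | 0 < inner ℝ v (x - q)} := by
  obtain ⟨v, hv⟩ := exists_ne (0 : V)
  by_contra! hcon
  have h1 := hcon (-v)
  have h2 := hcon v
  simp only [inner_neg_left, Left.neg_pos_iff] at h1
  have := ENNReal.add_lt_add h1 h2
  rw [measure_halfSpace_add hD q hv, ENNReal.inv_two_add_inv_two] at this
  exact lt_irrefl _ this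

/-- The points of a colour class all fall in an open half-space missing `q`, and of measure at
least `1 / 2`, with probability at least `2⁻ⁿ`. -/
theorem measure_mem_convexHull_le [Nontrivial V] {ι : Type*} [Fintype ι] {D : Measure V}
    [IsProbabilityMeasure D] (hD : D ≪ volume) (q : V) :
    (Measure.pi fun _ => D) {x : ι → V | q ∈ convexHull ℝ (Set.range x)} ≤
      1 - 2⁻¹ ^ Fintype.card ι := by
  obtain ⟨v, hv⟩ := exists_half_le_measure_halfSpace hD q
  set H : Set V := {x | 0 < inner ℝ v (x - q)} with hH
  have hconv : Convex ℝ H := by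
    have hset : H = {x | inner ℝ v q < innerₛₗ ℝ v x} := by
      ext x
      simp [hH, inner_sub_right]
    exact hset ▸ convex_halfSpace_gt (innerₛₗ ℝ v).isLinear (inner ℝ v q)
  have hsub : {x : ι → V | q ∈ convexHull ℝ (Set.range x)} ⊆ (Set.univ.pi fun _ => H)ᶜ := by
    intro x hx hxH
    have hq : q ∈ H := convexHull_min
      (Set.range_subset_iff.2 fun j => hxH j (Set.mem_univ j)) hconv hx
    simp [hH] at hq
  have hmeas : MeasurableSet (Set.univ.pi fun _ : ι => H) :=
    MeasurableSet.univ_pi fun _ => measurableSet_halfSpace v q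
  refine (measure_mono hsub).trans ?_
  rw [prob_compl_eq_one_sub hmeas, Measure.pi_pi, Finset.prod_const, Finset.card_univ]
  gcongr

theorem measure_determinedBy_le [Nontrivial V] {κ ι : Type*} [Fintype κ] [Fintype ι]
    {D : Measure V} [IsProbabilityMeasure D] (hD : D ≪ volume) (I : Finset κ) :
    (Measure.pi fun _ => D) (determinedBy I : Set (κ × ι → V)) ≤
      (1 - 2⁻¹ ^ Fintype.card ι) ^ (Fintype.card κ - I.card) := by
  classical
  have : ProperSpace V := FiniteDimensional.proper ℝ V
  refine pi_le_of_forall_piecewise D {a | a.1 ∈ I} (measurableSet_determinedBy I) fun x => ?_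
  have hcommon (y : κ × ι → V) :
      commonHull I ({a : κ × ι | a.1 ∈ I}.piecewise x y) = commonHull I x := by
    refine Set.iInter₂_congr fun i hi => ?_
    simp [Set.piecewise, hi]
  by_cases hne : (commonHull I x).Nonempty
  · obtain ⟨q, hq, hmin⟩ := exists_norm_le_of_mem_commonHull hne
    calc _ ≤ (Measure.pi fun _ => D) {y : κ × ι → V | ∀ i ∈ Iᶜ,
          (fun j => y (i, j)) ∈ {z : ι → V | q ∈ convexHull ℝ (Set.range z)}} := by
          refine measure_mono fun y hy i hi => ?_
          have hy' : {a : κ × ι | a.1 ∈ I}.piecewise x y ∈ determinedBy I := hy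
          have h := mem_commonHull_univ_of_mem_determinedBy hy' (q := q)
            ((hcommon y).symm ▸ hq) ((hcommon y).symm ▸ hmin)
          have h' := mem_commonHull.1 h i (Finset.mem_univ i)
          have hrow : (fun j => {a : κ × ι | a.1 ∈ I}.piecewise x y (i, j)) =
              fun j => y (i, j) :=
            funext fun j => Set.piecewise_eq_of_notMem _ _ _ (Finset.mem_compl.1 hi)
          exact hrow ▸ h'
      _ = ((Measure.pi fun _ => D) {z : ι → V | q ∈ convexHull ℝ (Set.range z)}) ^
          (Iᶜ).card := pi_setOf_forall_mem_colour D Iᶜ _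
      _ ≤ _ := by
          rw [Finset.card_compl]
          gcongr
          exact measure_mem_convexHull_le hD q
  · refine (measure_mono_null (t := ∅) (fun y hy => hne ?_) measure_empty).trans_le zero_le
    have := hy.1.mono (commonHull_anti (Finset.subset_univ I) _)
    rwa [hcommon] at this

theorem measure_nonempty_commonHull_le [Nontrivial V] {κ ι : Type*} [Fintype κ] [Fintype ι]
    {D : Measure V} [IsProbabilityMeasure D] (hD : D ≪ volume)
    (hκ : Module.finrank ℝ V ≤ Fintype.card κ) :
    (Measure.pi fun _ => D) {X : κ × ι → V | (commonHull Finset.univ X).Nonempty} ≤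
      (Fintype.card κ).choose (Module.finrank ℝ V) *
        (1 - 2⁻¹ ^ Fintype.card ι) ^ (Fintype.card κ - Module.finrank ℝ V) := by
  calc _ ≤ (Measure.pi fun _ => D) (⋃ I ∈ Finset.powersetCard (Module.finrank ℝ V) Finset.univ,
          (determinedBy I : Set (κ × ι → V))) := by
        refine measure_mono fun X hX => ?_
        obtain ⟨I, hI, hXI⟩ := exists_mem_determinedBy hκ hX
        exact Set.mem_iUnion₂.2 ⟨I, by simp [hI], hXI⟩
    _ ≤ ∑ I ∈ Finset.powersetCard (Module.finrank ℝ V) Finset.univ,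
          (Measure.pi fun _ => D) (determinedBy I : Set (κ × ι → V)) :=
        measure_biUnion_finset_le _ _
    _ ≤ ∑ I ∈ Finset.powersetCard (Module.finrank ℝ V) (Finset.univ : Finset κ),
          (1 - 2⁻¹ ^ Fintype.card ι) ^ (Fintype.card κ - Module.finrank ℝ V) := by
        refine Finset.sum_le_sum fun I hI => ?_
        rw [← (Finset.mem_powersetCard.1 hI).2]
        exact measure_determinedBy_le hD I
    _ = _ := by simp [Finset.card_powersetCard]

/-- If all closed half-spaces bounded by hyperplanes through `p` have measure less than `s`, then
by compactness of the unit sphere there are finitely many cones of measure at most `s` such that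
every nonempty finite set whose convex hull misses `p` lies in one of them. -/
theorem exists_measure_notMem_convexHull_le {D : Measure V} [IsProbabilityMeasure D] {p : V}
    {s : ENNReal} (hs : ∀ v : V, v ≠ 0 → D {x | 0 ≤ inner ℝ v (x - p)} < s) :
    ∃ N : ℕ, ∀ n : ℕ, 0 < n →
      (Measure.pi fun _ => D) {x : Fin n → V | p ∉ convexHull ℝ (Set.range x)} ≤ N * s ^ n := by
  classical
  have : ProperSpace V := FiniteDimensional.proper ℝ V
  let cone : V → ℝ → Set V := fun v η => {x | -(η * ‖x - p‖) ≤ inner ℝ v (x - p)}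
  have hcone (v : V) (η : ℝ) : MeasurableSet (cone v η) :=
    (isClosed_le (by fun_prop) (by fun_prop)).measurableSet
  have hη : ∀ v : V, ∃ η : ℝ, 0 < η ∧ (v ≠ 0 → D (cone v η) < s) := by
    intro v
    by_cases hv : v = 0
    · exact ⟨1, one_pos, fun h => absurd hv h⟩
    have hlim := tendsto_measure_iInter_atTop (μ := D)
      (s := fun k : ℕ => cone v (1 / ((k : ℝ) + 1)))
      (fun k => (hcone _ _).nullMeasurableSet)
      (fun k l hkl x (hx : _ ≤ _) => le_trans (neg_le_neg (mul_le_mul_of_nonneg_right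
        (one_div_le_one_div_of_le (by positivity) (by gcongr)) (norm_nonneg _))) hx)
      ⟨0, measure_ne_top _ _⟩
    have hlt : D (⋂ k : ℕ, cone v (1 / ((k : ℝ) + 1))) < s := by
      refine lt_of_le_of_lt (measure_mono fun x hx => ?_) (hs v hv)
      have h1 : Tendsto (fun k : ℕ => -(1 / ((k : ℝ) + 1) * ‖x - p‖)) atTop (𝓝 0) := by
        simpa using (tendsto_one_div_add_atTop_nhds_zero_nat.mul_const ‖x - p‖).neg
      exact le_of_tendsto h1 (Eventually.of_forall fun k => Set.mem_iInter.1 hx k)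
    obtain ⟨k, hk⟩ := (hlim.eventually (gt_mem_nhds hlt)).exists
    exact ⟨_, by positivity, fun _ => hk⟩
  choose η hη0 hηs using hη
  obtain ⟨T, hT, hcover⟩ := (isCompact_sphere (0 : V) 1).elim_nhds_subcover
    (fun v => Metric.ball v (η v)) (fun v _ => Metric.ball_mem_nhds v (hη0 v))
  refine ⟨T.card, fun n hn => ?_⟩
  have hsub : {x : Fin n → V | p ∉ convexHull ℝ (Set.range x)} ⊆
      ⋃ v ∈ T, Set.univ.pi fun _ => cone v (η v) := by
    intro x hx
    obtain ⟨g, u, hgp, hgx⟩ := geometric_hahn_banach_point_closed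
      (convex_convexHull ℝ (Set.range x)) ((Set.finite_range x).isClosed_convexHull ℝ) hx
    set w : V := (InnerProductSpace.toDual ℝ V).symm g with hw
    have hwpos (j : Fin n) : 0 < inner ℝ w (x j - p) := by
      rw [hw, InnerProductSpace.toDual_symm_apply, map_sub, sub_pos]
      exact hgp.trans (hgx _ (subset_convexHull ℝ _ ⟨j, rfl⟩))
    have hw0 : w ≠ 0 := by
      intro h
      have := hwpos ⟨0, hn⟩
      simp [h] at this
    have hsphere : ‖w‖⁻¹ • w ∈ Metric.sphere (0 : V) 1 := by
      simp [norm_smul, hw0]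
    obtain ⟨v, hvT, hv⟩ := Set.mem_iUnion₂.1 (hcover hsphere)
    refine Set.mem_iUnion₂.2 ⟨v, hvT, fun j _ => ?_⟩
    rw [mem_ball_iff_norm] at hv
    have h1 : 0 < inner ℝ (‖w‖⁻¹ • w) (x j - p) := by
      rw [real_inner_smul_left]
      exact mul_pos (by positivity) (hwpos j)
    have h2 : inner ℝ (‖w‖⁻¹ • w - v) (x j - p) ≤ η v * ‖x j - p‖ :=
      (real_inner_le_norm _ _).trans (by gcongr)
    rw [inner_sub_left] at h2
    change -(η v * ‖x j - p‖) ≤ inner ℝ v (x j - p)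
    linarith
  calc _ ≤ (Measure.pi fun _ => D) (⋃ v ∈ T, Set.univ.pi fun _ : Fin n => cone v (η v)) :=
        measure_mono hsub
    _ ≤ ∑ v ∈ T, (Measure.pi fun _ => D) (Set.univ.pi fun _ : Fin n => cone v (η v)) :=
        measure_biUnion_finset_le _ _
    _ ≤ ∑ v ∈ T, s ^ n := by
        refine Finset.sum_le_sum fun v hv => ?_
        have hv1 : v ≠ 0 := by
          rintro rfl
          simpa using hT 0 hv
        rw [Measure.pi_pi, Finset.prod_const, Finset.card_univ, Fintype.card_fin]
        gcongr
        exact (hηs v hv1).le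
    _ = T.card * s ^ n := by simp

end Hyperplane

/-! ### Convergence of the probabilities -/

theorem withHighProbability_of_tendsto_compl {Ω : ℕ → Type*} [∀ m, MeasurableSpace (Ω m)]
    {P : ∀ m, Measure (Ω m)} [∀ m, IsProbabilityMeasure (P m)] {A : ∀ m, Ω m → Prop}
    (h : Tendsto (fun m => P m {ω | ¬ A m ω}) atTop (𝓝 0)) : WithHighProbability P A := by
  have h1 : Tendsto (fun m => 1 - P m {ω | ¬ A m ω}) atTop (𝓝 1) := by
    simpa using ENNReal.Tendsto.sub tendsto_const_nhds h (Or.inl ENNReal.one_ne_top)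
  refine tendsto_of_tendsto_of_tendsto_of_le_of_le h1 tendsto_const_nhds (fun m => ?_)
    fun m => prob_le_one
  rw [tsub_le_iff_right, ← measure_univ (μ := P m)]
  refine (measure_mono fun ω _ => ?_).trans (measure_union_le _ _)
  exact em (A m ω)

theorem isTverberg_iff {d m n : ℕ} {X : Fin m × Fin n → EuclideanSpace ℝ (Fin d)} :
    IsTverberg X ↔ (commonHull Finset.univ X).Nonempty := by
  simp [IsTverberg, commonHull]

theorem tendsto_natCast_mul_pow_of_le_mul_logb {ε : ℝ} (hε : 0 < ε) {f : ℕ → ℕ}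
    (hf : ∀ᶠ m : ℕ in atTop, (1 + ε) * Real.logb 2 m ≤ (f m : ℝ)) :
    Tendsto (fun m : ℕ => (m : ℝ) * ((2 : ℝ) ^ (-(1 / (1 + ε / 2)))) ^ f m) atTop (𝓝 0) := by
  set c : ℝ := 1 / (1 + ε / 2) with hc
  have hc0 : 0 < c := by positivity
  have hexp : 0 < c * (1 + ε) - 1 := by
    rw [hc, sub_pos, div_mul_eq_mul_div, one_mul, lt_div_iff₀ (by positivity)]
    linarith
  refine squeeze_zero' (Eventually.of_forall fun m => by positivity) ?_
    ((tendsto_rpow_neg_atTop hexp).comp tendsto_natCast_atTop_atTop)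
  filter_upwards [hf, eventually_gt_atTop 0] with m hm hm0
  have hm0' : (0 : ℝ) < m := by exact_mod_cast hm0
  calc (m : ℝ) * ((2 : ℝ) ^ (-c)) ^ f m = m * (2 : ℝ) ^ (-c * f m) := by
        rw [← Real.rpow_natCast, ← Real.rpow_mul (by norm_num)]
    _ ≤ m * (2 : ℝ) ^ (Real.logb 2 m * (-(c * (1 + ε)))) := by
        have hexp_le : -c * f m ≤ Real.logb 2 m * (-(c * (1 + ε))) := by
          nlinarith [mul_le_mul_of_nonneg_left hm hc0.le]
        exact mul_le_mul_of_nonneg_left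
          (Real.rpow_le_rpow_of_exponent_le (by norm_num) hexp_le) hm0'.le
    _ = (m : ℝ) ^ (-(c * (1 + ε) - 1)) := by
        rw [Real.rpow_mul (by norm_num), Real.rpow_logb (by norm_num) (by norm_num) hm0']
        nth_rewrite 1 [← Real.rpow_one (m : ℝ)]
        rw [← Real.rpow_add hm0']
        ring_nf

theorem tendsto_choose_mul_pow_of_le_mul_logb (d : ℕ) {ε : ℝ} (hε : 0 < ε) {f : ℕ → ℕ}
    (hf : ∀ᶠ m : ℕ in atTop, (f m : ℝ) ≤ (1 - ε) * Real.logb 2 m) :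
    Tendsto (fun m : ℕ => (m.choose d : ℝ) * (1 - (2⁻¹ : ℝ) ^ f m) ^ (m - d)) atTop (𝓝 0) := by
  have hlim : Tendsto (fun m : ℕ => ((m : ℝ) ^ ε) ^ (d / ε) * Real.exp (-(1 / 2) * (m : ℝ) ^ ε))
      atTop (𝓝 0) :=
    (tendsto_rpow_mul_exp_neg_mul_atTop_nhds_zero (d / ε) (1 / 2) (by norm_num)).comp
      ((tendsto_rpow_atTop hε).comp tendsto_natCast_atTop_atTop)
  have hpow (m : ℕ) : (0 : ℝ) ≤ 1 - 2⁻¹ ^ f m :=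
    sub_nonneg.2 (pow_le_one₀ (by norm_num) (by norm_num))
  refine squeeze_zero' (Eventually.of_forall fun m => mul_nonneg (by positivity)
    (pow_nonneg (hpow m) _)) ?_ hlim
  filter_upwards [hf, eventually_gt_atTop 0, eventually_ge_atTop (2 * d)] with m hm hm0 hmd
  have hm0' : (0 : ℝ) < m := by exact_mod_cast hm0
  have hhalf : (m : ℝ) / 2 ≤ ((m - d : ℕ) : ℝ) := by
    have h2 : (2 * d : ℝ) ≤ m := by exact_mod_cast hmd
    rw [Nat.cast_sub (by omega)]
    linarith
  have hmiss : (m : ℝ) ^ (ε - 1) ≤ (2⁻¹ : ℝ) ^ f m := by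
    calc (m : ℝ) ^ (ε - 1) = (2 : ℝ) ^ (Real.logb 2 m * (ε - 1)) := by
          rw [Real.rpow_mul (by norm_num), Real.rpow_logb (by norm_num) (by norm_num) hm0']
      _ ≤ (2 : ℝ) ^ (-(f m : ℝ)) := by
          gcongr
          · norm_num
          · linarith
      _ = (2⁻¹ : ℝ) ^ f m := by
          rw [Real.rpow_neg (by norm_num), Real.rpow_natCast, inv_pow]
  have hchoose : (m.choose d : ℝ) ≤ ((m : ℝ) ^ ε) ^ (d / ε) := by
    rw [← Real.rpow_mul hm0'.le, mul_div_cancel₀ _ hε.ne', Real.rpow_natCast]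
    exact_mod_cast Nat.choose_le_pow m d
  have hexp : (1 - (2⁻¹ : ℝ) ^ f m) ^ (m - d) ≤ Real.exp (-(1 / 2) * (m : ℝ) ^ ε) := by
    calc (1 - (2⁻¹ : ℝ) ^ f m) ^ (m - d) ≤ Real.exp (-(2⁻¹ : ℝ) ^ f m) ^ (m - d) :=
          pow_le_pow_left₀ (hpow m) (Real.one_sub_le_exp_neg _) _
      _ = Real.exp (((m - d : ℕ) : ℝ) * -(2⁻¹ : ℝ) ^ f m) := (Real.exp_nat_mul _ _).symm
      _ ≤ Real.exp (-(1 / 2) * (m : ℝ) ^ ε) := by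
          refine Real.exp_le_exp.2 ?_
          have h1 : (m : ℝ) / 2 * (m : ℝ) ^ (ε - 1) ≤ ((m - d : ℕ) : ℝ) * (2⁻¹ : ℝ) ^ f m := by
            gcongr
          have h2 : (m : ℝ) * (m : ℝ) ^ (ε - 1) = (m : ℝ) ^ ε := by
            rw [Real.rpow_sub_one hm0'.ne', mul_div_cancel₀ _ hm0'.ne']
          linarith
  exact mul_le_mul hchoose hexp (pow_nonneg (hpow m) _) (by positivity)

instance {d m n : ℕ} (D : Measure (EuclideanSpace ℝ (Fin d))) [IsProbabilityMeasure D] :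
    IsProbabilityMeasure (equiPartitionLaw m n D) :=
  inferInstanceAs (IsProbabilityMeasure (Measure.pi fun _ => D))

/-- Balancedness and the vanishing of the measure of hyperplanes give every closed half-space
bounded by a hyperplane through `p` the measure `1 / 2`. -/
theorem BalancedAbout.measure_closedHalfSpace {d : ℕ} {D : Measure (EuclideanSpace ℝ (Fin d))}
    [IsProbabilityMeasure D] (hD : D ≪ volume) {p : EuclideanSpace ℝ (Fin d)}
    (hp : BalancedAbout D p) {v : EuclideanSpace ℝ (Fin d)} (hv : v ≠ 0) :
    D {x | 0 ≤ inner ℝ v (x - p)} = 2⁻¹ := by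
  have hle : D {x | 0 ≤ inner ℝ v (x - p)} = D {x | 0 < inner ℝ v (x - p)} := by
    refine le_antisymm ?_ (measure_mono fun x hx => le_of_lt (a := (0 : ℝ)) hx)
    calc D {x | 0 ≤ inner ℝ v (x - p)}
        ≤ D ({x | 0 < inner ℝ v (x - p)} ∪ {x | inner ℝ v (x - p) = 0}) :=
          measure_mono fun x hx => (lt_or_eq_of_le (show 0 ≤ inner ℝ v (x - p) from hx)).elim
            (fun h => Or.inl h) fun h => Or.inr h.symm
      _ ≤ _ := measure_union_le _ _
      _ = _ := by rw [measure_hyperplane_eq_zero hD p hv, add_zero]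
  have hsum := measure_halfSpace_add hD p hv
  rw [hp v hv, ← two_mul] at hsum
  rw [hle]
  exact ENNReal.eq_inv_of_mul_eq_one_left (by rwa [mul_comm])

theorem withHighProbability_isTverberg {d : ℕ} {D : Measure (EuclideanSpace ℝ (Fin d))}
    [IsProbabilityMeasure D] (hD : D ≪ volume) {p : EuclideanSpace ℝ (Fin d)}
    (hp : BalancedAbout D p) {f : ℕ → ℕ} {ε : ℝ} (hε : 0 < ε)
    (hf : ∀ᶠ m : ℕ in atTop, (1 + ε) * Real.logb 2 m ≤ (f m : ℝ)) :
    WithHighProbability (fun m => equiPartitionLaw m (f m) D) (fun _ X => IsTverberg X) := by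
  refine withHighProbability_of_tendsto_compl ?_
  -- any base strictly between `1 / 2` and `2 ^ (-1 / (1 + ε))` would do
  set σ : ℝ := (2 : ℝ) ^ (-(1 / (1 + ε / 2))) with hσ
  have hσ0 : 0 ≤ σ := by positivity
  have hσ2 : (2⁻¹ : ENNReal) < ENNReal.ofReal σ := by
    have h2 : (2⁻¹ : ENNReal) = ENNReal.ofReal 2⁻¹ := by
      rw [ENNReal.ofReal_inv_of_pos (by norm_num)]; simp
    rw [h2, ENNReal.ofReal_lt_ofReal_iff (by positivity), hσ, ← Real.rpow_neg_one]
    refine Real.rpow_lt_rpow_of_exponent_lt (by norm_num) (neg_lt_neg ?_)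
    rw [div_lt_one (by positivity)]
    linarith
  obtain ⟨N, hN⟩ := exists_measure_notMem_convexHull_le (D := D) (p := p)
    (s := ENNReal.ofReal σ) fun v hv => (hp.measure_closedHalfSpace hD hv).trans_lt hσ2
  have hlim := ENNReal.tendsto_ofReal
    ((tendsto_natCast_mul_pow_of_le_mul_logb hε hf).const_mul (N : ℝ))
  rw [mul_zero, ENNReal.ofReal_zero] at hlim
  refine tendsto_of_tendsto_of_tendsto_of_le_of_le' tendsto_const_nhds hlim
    (Eventually.of_forall fun _ => zero_le) ?_
  filter_upwards [hf, eventually_gt_atTop 1] with m hm hm1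
  have hfm : 0 < f m := by
    have := Real.logb_pos (b := 2) (by norm_num) (show (1 : ℝ) < m by exact_mod_cast hm1)
    exact_mod_cast (by positivity : 0 < (1 + ε) * Real.logb 2 m).trans_le hm
  simp only [isTverberg_iff]
  calc _ ≤ (m : ENNReal) * (Measure.pi fun _ => D)
          {x : Fin (f m) → EuclideanSpace ℝ (Fin d) | p ∉ convexHull ℝ (Set.range x)} := by
        simpa [equiPartitionLaw] using
          measure_isEmpty_commonHull_le (κ := Fin m) (ι := Fin (f m)) (D := D) p
    _ ≤ m * (N * ENNReal.ofReal σ ^ f m) := by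
        gcongr
        exact hN _ hfm
    _ = ENNReal.ofReal (N * (m * σ ^ f m)) := by
        rw [ENNReal.ofReal_mul (by positivity), ENNReal.ofReal_mul (by positivity),
          ENNReal.ofReal_pow hσ0, ENNReal.ofReal_natCast, ENNReal.ofReal_natCast]
        ring

theorem withHighProbability_not_isTverberg {d : ℕ} (hd : 0 < d)
    {D : Measure (EuclideanSpace ℝ (Fin d))} [IsProbabilityMeasure D] (hD : D ≪ volume)
    {f : ℕ → ℕ} {ε : ℝ} (hε : 0 < ε)
    (hf : ∀ᶠ m : ℕ in atTop, (f m : ℝ) ≤ (1 - ε) * Real.logb 2 m) :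
    WithHighProbability (fun m => equiPartitionLaw m (f m) D) (fun _ X => ¬ IsTverberg X) := by
  have : Nonempty (Fin d) := ⟨⟨0, hd⟩⟩
  refine withHighProbability_of_tendsto_compl ?_
  have hlim := ENNReal.tendsto_ofReal (tendsto_choose_mul_pow_of_le_mul_logb d hε hf)
  rw [ENNReal.ofReal_zero] at hlim
  refine tendsto_of_tendsto_of_tendsto_of_le_of_le' tendsto_const_nhds hlim
    (Eventually.of_forall fun _ => zero_le) ?_
  filter_upwards [eventually_ge_atTop d] with m hm
  simp only [not_not, isTverberg_iff]
  calc _ ≤ (m.choose d : ENNReal) * (1 - 2⁻¹ ^ f m) ^ (m - d) := by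
        simpa [equiPartitionLaw] using
          measure_nonempty_commonHull_le (κ := Fin m) (ι := Fin (f m)) hD (by simpa using hm)
    _ = ENNReal.ofReal (m.choose d * (1 - 2⁻¹ ^ f m) ^ (m - d)) := by
        rw [ENNReal.ofReal_mul (by positivity), ENNReal.ofReal_natCast, ENNReal.ofReal_pow
          (sub_nonneg.2 (pow_le_one₀ (by norm_num) (by norm_num))),
          ENNReal.ofReal_sub _ (by positivity), ENNReal.ofReal_one,
          ENNReal.ofReal_pow (by norm_num), ENNReal.ofReal_inv_of_pos (by norm_num),
          ENNReal.ofReal_ofNat]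

theorem theorem3p3 (d : ℕ) (hd : 0 < d)
    (D : Measure (EuclideanSpace ℝ (Fin d))) [IsProbabilityMeasure D] (hD : D ≪ volume)
    (p : EuclideanSpace ℝ (Fin d)) (hp : BalancedAbout D p) (f : ℕ → ℕ) :
    -- Tverberg with high probability when `f m ≫ log₂ m`
    ((fun m : ℕ => Real.logb 2 m) =o[atTop] (fun m : ℕ => (f m : ℝ)) →
      WithHighProbability (fun m => equiPartitionLaw m (f m) D) (fun _ X => IsTverberg X)) ∧
    -- not Tverberg with high probability when `f m ≪ log₂ m`
    ((fun m : ℕ => (f m : ℝ)) =o[atTop] (fun m : ℕ => Real.logb 2 m) →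
      WithHighProbability (fun m => equiPartitionLaw m (f m) D) (fun _ X => ¬ IsTverberg X)) ∧
    -- sharp form of the threshold: a constant factor above `log₂ m` suffices
    (∀ ε : ℝ, 0 < ε → (∀ᶠ m : ℕ in atTop, (1 + ε) * Real.logb 2 m ≤ (f m : ℝ)) →
      WithHighProbability (fun m => equiPartitionLaw m (f m) D) (fun _ X => IsTverberg X)) ∧
    -- sharp form of the threshold: a constant factor below `log₂ m` suffices
    (∀ ε : ℝ, 0 < ε → (∀ᶠ m : ℕ in atTop, (f m : ℝ) ≤ (1 - ε) * Real.logb 2 m) →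
      WithHighProbability (fun m => equiPartitionLaw m (f m) D) (fun _ X => ¬ IsTverberg X)) := by
  have hlog (m : ℕ) : 0 ≤ Real.logb 2 (m : ℝ) :=
    div_nonneg (Real.log_natCast_nonneg m) (Real.log_nonneg (by norm_num))
  refine ⟨fun h => ?_, fun h => ?_, fun ε hε hf => withHighProbability_isTverberg hD hp hε hf,
    fun ε hε hf => withHighProbability_not_isTverberg hd hD hε hf⟩
  · refine withHighProbability_isTverberg hD hp one_pos ?_
    filter_upwards [h.bound (show (0 : ℝ) < 1 / 2 by norm_num)] with m hm
    rw [Real.norm_of_nonneg (hlog m), Real.norm_of_nonneg (Nat.cast_nonneg _)] at hm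
    linarith
  · refine withHighProbability_not_isTverberg hd hD (ε := 1 / 2) (by norm_num) ?_
    filter_upwards [h.bound (show (0 : ℝ) < 1 / 2 by norm_num)] with m hm
    rw [Real.norm_of_nonneg (hlog m), Real.norm_of_nonneg (Nat.cast_nonneg _)] at hm
    linarith
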